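/- Let $G$ be a finite graph (multiple edges allowed, loops not allowed) with vertex set $V(G)$ and edge set $E(G)$; write $E(v)$ for the set of edges incident to $v$. Let $b : V(G)\to\mathbb{Z}_2$ be a colouring whose restriction to each connected component of $G$ has even parity, i.e. $\sum_{v\in C} b(v)=0$ in $\mathbb{Z}_2$ for every connected component $C$. Let $\Gamma(G,b)$ be the group generated by $\{x_e : e\in E(G)\}\cup\{J\}$ with relations $J^2=x_e^2=1$ and $[x_e,J]=1$ for all $e\in E(G)$; $[x_e,x_{e'}]=1$ for all $v\in V(G)$ and $e,e'\in E(v)$; and $\prod_{e\in E(v)}x_e=J^{b(v)}$ for all $v\in V(G)$. A deterministic strategy consists of functions $f_v,g_v:E(v)\to\mathbb{Z}_2$, $v\in V(G)$, with $\sum_{e\in E(v)}f_v(e)=\sum_{e\in E(v)}g_v(e)=b(v)$ for all $v$. Let $(\{f^{(i)}_v\},\{g^{(i)}_v\})$, $i=1,\dots,k$, be a complete list, without repetition, of the deterministic strategies. A commuting-operator strategy consists of a complex Hilbert space $\mathcal H$, a unit vector $\nu\in\mathcal H$, and self-adjoint unitary operators $\mathscr X_{ve},\mathscr Y_{ve}$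 on $\mathcal H$ ($v\in V(G)$, $e\in E(v)$) such that $\mathscr X_{ve}$ commutes with $\mathscr X_{ve'}$ and $\mathscr Y_{ve}$ commutes with $\mathscr Y_{ve'}$ for all $v\in V(G)$ and $e,e'\in E(v)$, $\mathscr X_{ve}$ commutes with $\mathscr Y_{ue'}$ for all $v,u\in V(G)$, $e\in E(v)$, $e'\in E(u)$, and $\prod_{e\in E(v)}\mathscr X_{ve}=\prod_{e\in E(v)}\mathscr Y_{ve}=(-1)^{b(v)}\mathbb 1$ for all $v\in V(G)$. It is perfect if $\langle\nu,\mathscr X_{ve}\mathscr Y_{ue}\nu\rangle=1$ for all $v,u\in V(G)$ and $e\in E(v)\cap E(u)$. Then $\Gamma(G,b)$ is abelian if and only if for every perfect commuting-operator strategy $\mathcal H,\nu,\{\mathscr X_{ve}\},\{\mathscr Y_{ve}\}$ there are a subspace $\mathcal H_0\subseteq\mathcal H$ which contains $\nu$ and is invariant under all $\mathscr X_{ve}$ and $\mathscr Y_{ve}$, a sequence $1\le i_1<\dots<i_m\le k$, an orthonormal basis $\nu_1,\dots,\nu_m$ of $\mathcal H_0$, and positive real numbers $\lambda_1,\dots,\lambda_m$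 such that $\nu=\sum_{j=1}^m\lambda_j\nu_j$ and $$\mathscr X_{ve}|_{\mathcal H_0}=\sum_{j=1}^m(-1)^{f_v^{(i_j)}(e)}\,\nu_j\nu_j^*,\qquad \mathscr Y_{ve}|_{\mathcal H_0}=\sum_{j=1}^m(-1)^{g_v^{(i_j)}(e)}\,\nu_j\nu_j^*$$ for all $v\in V(G)$ and $e\in E(v)$, where $\nu_j\nu_j^*$ is the map $\xi\mapsto\langle\nu_j,\xi\rangle\nu_j$. -/

import Mathlib

open scoped Graph

universe u v w

namespace GraphIncidence

/-- `l` lists every element of `ι` exactly once (an ordering of the finite type `ι`). -/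
def IsEnumeration {ι : Type*} (l : List ι) : Prop :=
  l.Nodup ∧ ∀ i, i ∈ l

variable {α : Type u} {β : Type v} {G : Graph α β}

/-- The restriction of the colouring `b` to each connected component of `G` has even parity.
The components of a multigraph are those of its underlying simple graph. -/
def EvenOnComponents (b : V(G) → ZMod 2) : Prop :=
  ∀ C : G.toSimpleGraph.ConnectedComponent, ∑ᶠ x ∈ C.supp, b x = 0

variable (G) in
/-- The generators `x_e`, for the edges `e` of `G`, and `J`. -/
inductive Generator : Type v
  | edge (e : E(G)) : Generator
  | center : Generator

/-- The free generator `x_e`. -/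
def freeX (e : E(G)) : FreeGroup (Generator G) := FreeGroup.of (Generator.edge e)

variable (G) in
/-- The free generator `J`. -/
def freeJ : FreeGroup (Generator G) := FreeGroup.of Generator.center

/-- An edge incident to `x`, as an edge of `G`. -/
def toEdge (x : V(G)) (e : G.incidenceSet x) : E(G) :=
  ⟨e.1, G.incidenceSet_subset_edgeSet x e.2⟩

/-- The defining relators. Since the edges at a vertex are made to commute, the product around a
vertex does not depend on the order of the factors; the relator is imposed for every order. -/
inductive IsRelator (b : V(G) → ZMod 2) : FreeGroup (Generator G) → Prop
  | J_sq : IsRelator b (freeJ G ^ 2)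
  | x_sq (e : E(G)) : IsRelator b (freeX e ^ 2)
  | x_J (e : E(G)) : IsRelator b (freeX e * freeJ G * (freeX e)⁻¹ * (freeJ G)⁻¹)
  | x_x (x : V(G)) (e e' : G.incidenceSet x) :
      IsRelator b (freeX (toEdge x e) * freeX (toEdge x e') *
        (freeX (toEdge x e))⁻¹ * (freeX (toEdge x e'))⁻¹)
  | vertex (x : V(G)) (l : List (G.incidenceSet x)) (hl : IsEnumeration l) :
      IsRelator b ((l.map fun e => freeX (toEdge x e)).prod * (freeJ G ^ (b x).val)⁻¹)

/-- The graph incidence group `Γ(G, b)`. -/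
abbrev IncidenceGroup (b : V(G) → ZMod 2) : Type v :=
  PresentedGroup {r : FreeGroup (Generator G) | IsRelator b r}

/-- A deterministic strategy for the graph incidence game of `(G, b)`: each player answers a
vertex `x` with a labelling of the edges at `x` which sums to `b x`. -/
@[ext]
structure DeterministicStrategy (b : V(G) → ZMod 2) where
  f : (x : V(G)) → G.incidenceSet x → ZMod 2
  g : (x : V(G)) → G.incidenceSet x → ZMod 2
  sum_f : ∀ x, ∑ᶠ e, f x e = b x
  sum_g : ∀ x, ∑ᶠ e, g x e = b x

/-- A `{±1}`-valued observable: a self-adjoint unitary operator. -/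
def IsObservable {H : Type w} [NormedAddCommGroup H] [InnerProductSpace ℂ H] [CompleteSpace H]
    (T : H →L[ℂ] H) : Prop :=
  IsSelfAdjoint T ∧ T ∈ unitary (H →L[ℂ] H)

/-- A commuting-operator strategy for the graph incidence game of `(G, b)` on the Hilbert
space `H`. -/
structure CommutingOperatorStrategy (b : V(G) → ZMod 2) (H : Type w) [NormedAddCommGroup H]
    [InnerProductSpace ℂ H] [CompleteSpace H] where
  ν : H
  norm_ν : ‖ν‖ = 1
  X : (x : V(G)) → G.incidenceSet x → H →L[ℂ] H
  Y : (x : V(G)) → G.incidenceSet x → H →L[ℂ] H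
  observable_X : ∀ x e, IsObservable (X x e)
  observable_Y : ∀ x e, IsObservable (Y x e)
  commute_X : ∀ x e e', Commute (X x e) (X x e')
  commute_Y : ∀ x e e', Commute (Y x e) (Y x e')
  commute_X_Y : ∀ x y e e', Commute (X x e) (Y y e')
  /-- The factors commute, so the product may be taken in any order. -/
  prod_X : ∀ (x : V(G)) (l : List (G.incidenceSet x)), IsEnumeration l →
    (l.map (X x)).prod = ((-1 : ℂ) ^ (b x).val) • 1
  prod_Y : ∀ (x : V(G)) (l : List (G.incidenceSet x)), IsEnumeration l →
    (l.map (Y x)).prod = ((-1 : ℂ) ^ (b x).val) • 1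

/-- A commuting-operator strategy is perfect if the two players' values for a common edge are
perfectly correlated. -/
def CommutingOperatorStrategy.IsPerfect {b : V(G) → ZMod 2} {H : Type w} [NormedAddCommGroup H]
    [InnerProductSpace ℂ H] [CompleteSpace H] (S : CommutingOperatorStrategy b H) : Prop :=
  ∀ (x y : V(G)) (e : β) (hx : e ∈ G.incidenceSet x) (hy : e ∈ G.incidenceSet y),
    inner ℂ S.ν (S.X x ⟨e, hx⟩ (S.Y y ⟨e, hy⟩ S.ν)) = 1

end GraphIncidence

namespace GraphIncidence

variable {α : Type u} {β : Type v} {G : Graph α β}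

/-! Suppose `Γ(G, b)` is abelian and a perfect strategy is given. Perfectness and unit norms force
`X_{xe} ν = Y_{ye} ν` at any two endpoints `x`, `y` of `e`. Let `K` be the space of vectors `T ν`
with `T` in the commutant of the first player's operators. On `K` the operator `X_{xe}` no longer
depends on the endpoint `x`, so these operators represent `Γ(G, b)` with `J ↦ -1`
(`IsPerfect.exists_representation`). The group algebra is commutative, so its involutions `x_e` have
joint spectral idempotents `p_φ` summing to `1`, one for each labelling `φ` of the edges. The
vectors `p_φ ν` sum to `ν` and are joint eigenvectors of the `X`, and of the `Y` with the same
signs, because the `Y` commute with the representation and agree with the `X` on `ν`. The nonzero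
ones are orthogonal, and the vertex relations make their labels solutions of the incidence system,
hence deterministic strategies (`exists_decomposition`).

Conversely, even parity yields a solution of the system over `ZMod 2`, hence a sign character `χ` of
`Γ(G, b)` with `χ(J) = -1`. Twisting the left and right regular representations of `Q = Γ(G, b)/⟨J⟩`
by `χ` gives a perfect strategy with state `δ_1`. A diagonal decomposition makes the `X` commute on
`δ_1`, which forces `Q` to be abelian. Commutators of `Γ(G, b)` then lie in `⟨J⟩`, where `χ` is
injective, while `χ` kills commutators; so they are trivial (`commute_of_strategy_commute`). -/

lemma exists_mem_incidenceSet (e : E(G)) : ∃ x : V(G), e.1 ∈ G.incidenceSet x := by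
  obtain ⟨x, y, h⟩ := Graph.exists_isLink_of_mem_edgeSet e.2
  exact ⟨⟨x, h.left_mem⟩, h.inc_left⟩

instance [Finite E(G)] (x : V(G)) : Finite (G.incidenceSet x) :=
  Finite.of_injective (toEdge x) fun _ _ h => Subtype.ext (congrArg (fun t : E(G) => t.1) h)

lemma exists_isEnumeration (ι : Type*) [Finite ι] : ∃ l : List ι, IsEnumeration l := by
  have := Fintype.ofFinite ι
  exact ⟨Finset.univ.toList, Finset.nodup_toList _, fun i => by simp⟩

lemma IsEnumeration.sum_eq {ι M : Type*} [AddCommMonoid M] {l : List ι} (hl : IsEnumeration l)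
    (f : ι → M) : (l.map f).sum = ∑ᶠ i, f i := by
  classical
  rw [finsum_eq_sum_of_support_subset (s := l.toFinset) f (fun i _ => by simpa using hl.2 i),
    List.sum_toFinset f hl.1]

/-! ### Solving the incidence system over `ZMod 2`. -/

section Solutions

variable (G) in
/-- The colourings of the vertices which are realised by a labelling of the edges. -/
def boundarySpace [Finite E(G)] : AddSubgroup (V(G) → ZMod 2) where
  carrier := {b | ∃ f : E(G) → ZMod 2, ∀ x, ∑ᶠ e, f (toEdge x e) = b x}
  zero_mem' := ⟨0, fun x => by simp⟩
  add_mem' := by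
    rintro b c ⟨f, hf⟩ ⟨g, hg⟩
    exact ⟨f + g, fun x => by
      simp only [Pi.add_apply, ← hf, ← hg]
      exact finsum_add_distrib (Set.toFinite _) (Set.toFinite _)⟩
  neg_mem' := by
    rintro b ⟨f, hf⟩
    exact ⟨-f, fun x => by simp only [Pi.neg_apply, ← hf, finsum_neg_distrib]⟩

open Classical in
-- The witness is the labelling supported on the single edge `e`; without loops its endpoints are
-- distinct, and each sees `e` once.
lemma single_add_single_mem_boundarySpace_of_isLink [G.Loopless] [Finite E(G)] {e : β}
    {x y : V(G)} (h : G.IsLink e x y) :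
    Pi.single x 1 + Pi.single y 1 ∈ boundarySpace G := by
  refine ⟨Pi.single ⟨e, h.edge_mem⟩ 1, fun z => ?_⟩
  have hxy : x ≠ y := fun hxy => h.ne (congrArg Subtype.val hxy)
  by_cases hz : e ∈ G.incidenceSet z
  · rw [finsum_eq_single _ ⟨e, hz⟩]
    · have : z = x ∨ z = y := by
        rcases Graph.Inc.eq_or_eq_of_isLink hz h with h | h
        · exact .inl (Subtype.ext h)
        · exact .inr (Subtype.ext h)
      rcases this with rfl | rfl
      · simp [toEdge, hxy]
      · simp [toEdge, hxy.symm]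
    · intro e' he'
      refine Pi.single_eq_of_ne (M := fun _ => ZMod 2) (fun h' => he' ?_) _
      have : e'.1 = e := congrArg Subtype.val h'
      exact Subtype.ext this
  · have h1 : z ≠ x := by rintro rfl; exact hz h.inc_left
    have h2 : z ≠ y := by rintro rfl; exact hz h.inc_right
    rw [finsum_congr (g := fun _ => (0 : ZMod 2)), finsum_zero]
    · simp [h1, h2]
    · intro e'
      refine Pi.single_eq_of_ne (M := fun _ => ZMod 2) (fun h' => hz ?_) _
      have : e'.1 = e := congrArg Subtype.val h'
      exact this ▸ e'.2

open Classical in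
-- The sums of endpoints along a walk telescope modulo 2.
lemma single_add_single_mem_boundarySpace_of_reachable [G.Loopless] [Finite E(G)]
    {x y : V(G)} (h : G.toSimpleGraph.Reachable x y) :
    Pi.single x 1 + Pi.single y 1 ∈ boundarySpace G := by
  obtain ⟨p⟩ := h
  induction p with
  | nil =>
    rw [← two_nsmul, show (2 : ℕ) • (Pi.single _ 1 : V(G) → ZMod 2) = 0 from
      funext fun _ => ZModModule.char_nsmul_eq_zero 2 _]
    exact zero_mem _
  | @cons x y z h p ih =>
    obtain ⟨e, he⟩ := (Graph.toSimpleGraph_adj_iff _ _).1 h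
    have := add_mem (single_add_single_mem_boundarySpace_of_isLink he) ih
    convert this using 1
    funext t
    simp only [Pi.add_apply]
    linear_combination -CharTwo.add_self_eq_zero (Pi.single (M := fun _ => ZMod 2) y 1 t)

/-- The incidence system of a loopless graph is solvable over `ZMod 2` when the colouring has even
parity on each component. -/
theorem EvenOnComponents.exists_solution [G.Loopless] [Finite V(G)] [Finite E(G)]
    {b : V(G) → ZMod 2} (hb : EvenOnComponents b) :
    ∃ f : E(G) → ZMod 2, ∀ x, ∑ᶠ e, f (toEdge x e) = b x := by
  classical
  have := Fintype.ofFinite V(G)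
  -- `r x` is a chosen root of the component of `x`. Pairing every vertex of colour 1 with its root
  -- gives `b` plus root terms, and these vanish by even parity.
  let r : V(G) → V(G) := fun x => (G.toSimpleGraph.connectedComponentMk x).out
  have hr (x) : G.toSimpleGraph.connectedComponentMk (r x) =
    G.toSimpleGraph.connectedComponentMk x := Quot.out_eq _
  suffices h : b = ∑ x, b x • (Pi.single x 1 + Pi.single (r x) 1 : V(G) → ZMod 2) by
    have hmem : b ∈ boundarySpace G := by
      rw [h]
      refine sum_mem fun x _ => ZMod.smul_mem
        (single_add_single_mem_boundarySpace_of_reachable ?_) _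
      exact (SimpleGraph.ConnectedComponent.exact (hr x)).symm
    exact hmem
  funext y
  -- At a root the coefficient is the parity of its component; at any other vertex no term
  -- contributes.
  have key : ∑ x, b x * (Pi.single (r x) 1 : V(G) → ZMod 2) y = 0 := by
    by_cases hy : r y = y
    · rw [← hb (G.toSimpleGraph.connectedComponentMk y), finsum_mem_eq_sum_of_inter_support_eq
        (t := Finset.univ.filter fun x => r x = y)]
      · rw [Finset.sum_filter]
        refine Finset.sum_congr rfl fun x _ => ?_
        by_cases hx : r x = y
        · simp [hx]
        · simp [hx, Ne.symm hx]
      · congr 1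
        ext x
        simp only [SimpleGraph.ConnectedComponent.mem_supp_iff, Finset.coe_filter,
          Finset.mem_univ, true_and, Set.mem_ofPred_eq]
        constructor
        · intro h
          rw [← hy]
          simp only [r]
          rw [h]
        · intro h
          rw [← h, hr]
    · refine Finset.sum_eq_zero fun x _ => ?_
      have : y ≠ r x := by
        rintro rfl
        apply hy
        change (G.toSimpleGraph.connectedComponentMk (r x)).out = _
        rw [hr]
      simp [this]
  simp only [Finset.sum_apply, Pi.smul_apply, Pi.add_apply, smul_eq_mul, mul_add,
    Finset.sum_add_distrib, key]
  simp [Pi.single_apply]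

end Solutions

/-! ### The incidence group and its sign characters. -/

section Group

variable {b : V(G) → ZMod 2}

/-- The generator `x_e` of the graph incidence group. -/
def edgeElt (b : V(G) → ZMod 2) (e : E(G)) : IncidenceGroup b := PresentedGroup.of (.edge e)

/-- The central generator `J` of the graph incidence group. -/
def centralElt (b : V(G) → ZMod 2) : IncidenceGroup b := PresentedGroup.of .center

lemma centralElt_sq : centralElt b ^ 2 = 1 :=
  PresentedGroup.one_of_mem (rels := {r | IsRelator b r}) IsRelator.J_sq

lemma edgeElt_sq (e : E(G)) : edgeElt b e ^ 2 = 1 :=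
  PresentedGroup.one_of_mem (rels := {r | IsRelator b r}) (IsRelator.x_sq e)

lemma commute_edgeElt_centralElt (e : E(G)) : Commute (edgeElt b e) (centralElt b) := by
  have := PresentedGroup.one_of_mem (rels := {r | IsRelator b r}) (IsRelator.x_J e)
  exact commutatorElement_eq_one_iff_commute.1 this

lemma commute_edgeElt_edgeElt (x : V(G)) (e e' : G.incidenceSet x) :
    Commute (edgeElt b (toEdge x e)) (edgeElt b (toEdge x e')) := by
  have := PresentedGroup.one_of_mem (rels := {r | IsRelator b r}) (IsRelator.x_x x e e')
  exact commutatorElement_eq_one_iff_commute.1 this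

lemma prod_edgeElt (x : V(G)) {l : List (G.incidenceSet x)} (hl : IsEnumeration l) :
    (l.map fun e => edgeElt b (toEdge x e)).prod = centralElt b ^ (b x).val := by
  have := PresentedGroup.one_of_mem (rels := {r | IsRelator b r}) (IsRelator.vertex x l hl)
  rw [map_mul, map_inv, map_pow, map_list_prod, List.map_map] at this
  exact mul_inv_eq_one.1 this

lemma incidenceGroup_induction {P : IncidenceGroup b → Prop} (one : P 1)
    (mul : ∀ z z', P z → P z' → P (z * z')) (inv : ∀ z, P z → P z⁻¹)
    (edge : ∀ e, P (edgeElt b e)) (center : P (centralElt b)) (z : IncidenceGroup b) : P z := by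
  have hz : z ∈ Subgroup.closure (Set.range (PresentedGroup.of (rels := {r | IsRelator b r}))) := by
    rw [PresentedGroup.closure_range_of]; trivial
  induction hz using Subgroup.closure_induction with
  | mem z h => obtain ⟨e | _, rfl⟩ := h; exacts [edge e, center]
  | one => exact one
  | mul z z' _ _ h h' => exact mul z z' h h'
  | inv z _ h => exact inv z h

/-- A homomorphism out of the graph incidence group, from the images of the generators. -/
theorem exists_incidenceGroup_hom {Q : Type*} [Group Q] (j : Q) (q : E(G) → Q) (hj : j ^ 2 = 1)
    (hq : ∀ e, q e ^ 2 = 1) (hqj : ∀ e, Commute (q e) j)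
    (hqq : ∀ (x : V(G)) (e e' : G.incidenceSet x), Commute (q (toEdge x e)) (q (toEdge x e')))
    (hprod : ∀ (x : V(G)) (l : List (G.incidenceSet x)), IsEnumeration l →
      (l.map fun e => q (toEdge x e)).prod = j ^ (b x).val) :
    ∃ φ : IncidenceGroup b →* Q, φ (centralElt b) = j ∧ ∀ e, φ (edgeElt b e) = q e := by
  let F : Generator G → Q := fun s => Generator.casesOn s q j
  have hF : ∀ r ∈ {r : FreeGroup (Generator G) | IsRelator b r}, FreeGroup.lift F r = 1 := by
    intro r hr
    have hx (e) : FreeGroup.lift F (freeX e) = q e := FreeGroup.lift_apply_of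
    have hJ : FreeGroup.lift F (freeJ G) = j := FreeGroup.lift_apply_of
    induction hr with
    | J_sq => simp [hJ, hj]
    | x_sq e => simp [hx, hq]
    | x_J e => simpa [hx, hJ, commutatorElement_def] using
        commutatorElement_eq_one_iff_commute.2 (hqj e)
    | x_x x e e' => simpa [hx, commutatorElement_def] using
        commutatorElement_eq_one_iff_commute.2 (hqq x e e')
    | vertex x l hl =>
      rw [map_mul, map_inv, map_pow, map_list_prod, List.map_map, hJ, mul_inv_eq_one,
        ← hprod x l hl]
      congr 1
      exact List.map_congr_left fun e _ => hx _
  exact ⟨PresentedGroup.toGroup hF, PresentedGroup.toGroup.of hF,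
    fun _ => PresentedGroup.toGroup.of hF⟩

lemma centralElt_mem_center : centralElt b ∈ Subgroup.center (IncidenceGroup b) := by
  refine Subgroup.mem_center_iff.2 fun z => ?_
  induction z using incidenceGroup_induction with
  | one => simp
  | mul z z' h h' => exact Commute.mul_left h h'
  | inv z h => exact Commute.inv_left (a := z) (b := centralElt b) h
  | edge e => exact commute_edgeElt_centralElt e
  | center => rfl

/-- Countability allows a quotient of the group to be moved to an arbitrary universe, where the
Hilbert spaces live. -/
instance [Finite E(G)] : Countable (IncidenceGroup b) := by
  have : Finite (Generator G) :=
    Finite.of_injective (β := Option E(G)) (fun s => Generator.casesOn s some none)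
      (by rintro (e | _) (e' | _) h <;> simp_all)
  have : Countable (FreeGroup (Generator G)) :=
    Function.Surjective.countable (f := FreeGroup.mk) Quot.mk_surjective
  exact Function.Surjective.countable
    (f := PresentedGroup.mk {r : FreeGroup (Generator G) | IsRelator b r})
    (PresentedGroup.mk_surjective _)

/-- A solution of the incidence system gives a character of the incidence group with `J ↦ -1`. -/
theorem exists_sign_character [Finite E(G)] {f : E(G) → ZMod 2}
    (hf : ∀ x, ∑ᶠ e, f (toEdge x e) = b x) :
    ∃ χ : IncidenceGroup b →* ℂˣ, χ (centralElt b) = -1 ∧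
      ∀ z, χ z = 1 ∨ χ z = -1 := by
  have hsq (a : ZMod 2) : (Multiplicative.ofAdd a) ^ 2 = 1 := by
    revert a; decide
  obtain ⟨φ, hJ, hφ⟩ := exists_incidenceGroup_hom (b := b) (Q := Multiplicative (ZMod 2))
    (.ofAdd 1) (fun e => .ofAdd (f e)) (hsq _) (fun _ => hsq _) (fun _ => Commute.all _ _)
    (fun _ _ _ => Commute.all _ _) (fun x l hl => by
      rw [← ofAdd_nsmul, nsmul_one, ZMod.natCast_val, ZMod.cast_id', id, ← hf, ← hl.sum_eq,
        ofAdd_list_prod, List.map_map]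
      rfl)
  let s : Multiplicative (ZMod 2) →* ℂˣ :=
    { toFun a := (-1) ^ a.toAdd.val
      map_one' := by simp
      map_mul' := by
        have : ∀ a a' : ZMod 2, (-1 : ℂˣ) ^ (a + a').val = (-1) ^ a.val * (-1) ^ a'.val := by
          intro a a'
          rw [← pow_add, ZMod.val_add, ← pow_eq_pow_mod _ (by simp)]
        exact this }
  refine ⟨s.comp φ, ?_, fun z => neg_one_pow_eq_or _ _⟩
  rw [MonoidHom.comp_apply, hJ]
  exact pow_one (-1 : ℂˣ)

end Group

/-! ### Regular representations and the converse implication. -/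

section Regular

open scoped ENNReal lp

variable {ι : Type w}

/-- The unitary on `ℓ²(ι)` permuting the coordinates. -/
noncomputable def permOp : Equiv.Perm ι →* (ℓ²(ι, ℂ) →L[ℂ] ℓ²(ι, ℂ)) where
  toFun σ := LinearMap.mkContinuous
    { toFun ξ := ⟨fun i => ξ (σ⁻¹ i), memℓp_gen
        ((σ⁻¹).summable_iff.2 ((lp.memℓp ξ).summable (by norm_num)))⟩
      map_add' _ _ := rfl
      map_smul' _ _ := rfl } 1 fun ξ => by
        rw [one_mul]
        refine le_of_eq ?_
        rw [lp.norm_eq_tsum_rpow (by norm_num), lp.norm_eq_tsum_rpow (by norm_num)]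
        congr 1
        exact (σ⁻¹).tsum_eq fun i => ‖ξ i‖ ^ (2 : ℝ≥0∞).toReal
  map_one' := rfl
  map_mul' _ _ := rfl

lemma permOp_apply (σ : Equiv.Perm ι) (ξ : ℓ²(ι, ℂ)) (i : ι) : permOp σ ξ i = ξ (σ⁻¹ i) := rfl

lemma norm_permOp (σ : Equiv.Perm ι) (ξ : ℓ²(ι, ℂ)) : ‖permOp σ ξ‖ = ‖ξ‖ := by
  rw [lp.norm_eq_tsum_rpow (by norm_num), lp.norm_eq_tsum_rpow (by norm_num)]
  congr 1
  exact (σ⁻¹).tsum_eq fun i => ‖ξ i‖ ^ (2 : ℝ≥0∞).toReal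

lemma permOp_single [DecidableEq ι] (σ : Equiv.Perm ι) (i : ι) (a : ℂ) :
    permOp σ (lp.single 2 i a) = lp.single 2 (σ i) a := by
  ext j
  rw [permOp_apply, lp.single_apply, lp.single_apply, Pi.single_apply, Pi.single_apply]
  simp only [Equiv.Perm.inv_eq_iff_eq]

end Regular

/-- An isometry satisfies `T* T = 1`, so multiplying `T² = 1` on the left by `T*` gives `T* = T`. -/
lemma isObservable_of_norm_preserving {H : Type w} [NormedAddCommGroup H] [InnerProductSpace ℂ H]
    [CompleteSpace H] {T : H →L[ℂ] H} (hT : ∀ ξ, ‖T ξ‖ = ‖ξ‖) (hT2 : T * T = 1) :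
    IsObservable T := by
  have h : star T * T = 1 := (ContinuousLinearMap.norm_map_iff_adjoint_comp_self T).1 hT
  have hs : star T = T := by
    calc star T = star T * (T * T) := by rw [hT2, mul_one]
      _ = T := by rw [← mul_assoc, h, one_mul]
  exact ⟨hs, by rw [Unitary.mem_iff]; exact ⟨h, by rw [hs, hT2]⟩⟩

/-- Two commuting isometric representations of the incidence group with `J ↦ -1`, and a vector
fixed by all `x_e ⊗ x_e`, give a perfect strategy. -/
theorem exists_perfect_of_representations {b : V(G) → ZMod 2} {H : Type w} [NormedAddCommGroup H]
    [InnerProductSpace ℂ H] [CompleteSpace H] (A B : IncidenceGroup b →* (H →L[ℂ] H))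
    (hA : ∀ z ξ, ‖A z ξ‖ = ‖ξ‖) (hB : ∀ z ξ, ‖B z ξ‖ = ‖ξ‖)
    (hAB : ∀ z z', Commute (A z) (B z'))
    (hAJ : A (centralElt b) = (-1 : ℂ) • 1) (hBJ : B (centralElt b) = (-1 : ℂ) • 1)
    (ν : H) (hν : ‖ν‖ = 1) (hfix : ∀ e, A (edgeElt b e) (B (edgeElt b e) ν) = ν) :
    ∃ S : CommutingOperatorStrategy b H, S.IsPerfect ∧ S.ν = ν ∧
      ∀ x e, S.X x e = A (edgeElt b (toEdge x e)) := by
  have hprod (C : IncidenceGroup b →* (H →L[ℂ] H)) (hC : C (centralElt b) = (-1 : ℂ) • 1)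
      (x : V(G)) (l : List (G.incidenceSet x)) (hl : IsEnumeration l) :
      (l.map fun e => C (edgeElt b (toEdge x e))).prod = ((-1 : ℂ) ^ (b x).val) • 1 := by
    have := congrArg C (prod_edgeElt (b := b) x hl)
    rw [map_list_prod, List.map_map, map_pow, hC, smul_pow, one_pow] at this
    exact this
  have hobs (C : IncidenceGroup b →* (H →L[ℂ] H)) (hC : ∀ z ξ, ‖C z ξ‖ = ‖ξ‖) (e : E(G)) :
      IsObservable (C (edgeElt b e)) :=
    isObservable_of_norm_preserving (hC _) (by rw [← map_mul, ← pow_two, edgeElt_sq, map_one])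
  refine ⟨{ ν := ν
            norm_ν := hν
            X x e := A (edgeElt b (toEdge x e))
            Y x e := B (edgeElt b (toEdge x e))
            observable_X _ _ := hobs A hA _
            observable_Y _ _ := hobs B hB _
            commute_X _ _ _ := (commute_edgeElt_edgeElt _ _ _).map A
            commute_Y _ _ _ := (commute_edgeElt_edgeElt _ _ _).map B
            commute_X_Y _ _ _ _ := hAB _ _
            prod_X := hprod A hAJ
            prod_Y := hprod B hBJ }, ?_, rfl, fun _ _ => rfl⟩
  intro x y e hx hy
  change inner ℂ ν (A (edgeElt b (toEdge x ⟨e, hx⟩)) (B (edgeElt b (toEdge x ⟨e, hx⟩)) ν)) = 1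
  rw [hfix, inner_self_eq_norm_sq_to_K, hν]
  simp

/-- A representation twisted by a scalar character. -/
def twist {Γ : Type*} [Group Γ] {R : Type*} [Ring R] [Algebra ℂ R] (χ : Γ →* ℂˣ) (U : Γ →* R) :
    Γ →* R where
  toFun z := (χ z : ℂ) • U z
  map_one' := by simp
  map_mul' z z' := by simp [smul_smul, mul_comm]

/-- The perfect strategy on `ℓ²(Q)` given by the left and right regular representations of a
quotient `Q` in which `J` is trivial. -/
theorem exists_regular_strategy {b : V(G) → ZMod 2} (χ : IncidenceGroup b →* ℂˣ)
    (hχJ : χ (centralElt b) = -1) (hχ : ∀ z, χ z = 1 ∨ χ z = -1) {Q : Type w} [Group Q]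
    [DecidableEq Q] (p : IncidenceGroup b →* Q) (hp : p (centralElt b) = 1) :
    ∃ S : CommutingOperatorStrategy b (lp (fun _ : Q => ℂ) 2), S.IsPerfect ∧
      S.ν = lp.single 2 1 1 ∧
      ∀ x e q, S.X x e (lp.single 2 q 1) = (χ (edgeElt b (toEdge x e)) : ℂ) •
        lp.single 2 (p (edgeElt b (toEdge x e)) * q) 1 := by
  let left : Q →* Equiv.Perm Q := MulAction.toPermHom Q Q
  let right : Q →* Equiv.Perm Q :=
    { toFun q := Equiv.mulRight q⁻¹
      map_one' := by ext; simp
      map_mul' q q' := by ext; simp [mul_assoc] }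
  let A := twist χ (permOp.comp (left.comp p))
  let B := twist χ (permOp.comp (right.comp p))
  have hA (z) : A z = (χ z : ℂ) • permOp (left (p z)) := rfl
  have hB (z) : B z = (χ z : ℂ) • permOp (right (p z)) := rfl
  have hnorm (z) (σ : Equiv.Perm Q) (ξ) : ‖((χ z : ℂ) • permOp σ) ξ‖ = ‖ξ‖ := by
    rw [smul_apply, norm_smul, norm_permOp]
    rcases hχ z with h | h <;> simp [h]
  have hlr (q q' : Q) : Commute (left q) (right q') := by
    ext t
    simp [left, right, mul_assoc]
  obtain ⟨S, hS, hSν, hSX⟩ := exists_perfect_of_representations A B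
    (fun z ξ => by rw [hA, hnorm]) (fun z ξ => by rw [hB, hnorm])
    (fun z z' => by
      rw [hA, hB]
      exact (((hlr _ _).map permOp).smul_left _).smul_right _)
    (by simp [hA, hp, hχJ]) (by simp [hB, hp, hχJ]) (lp.single 2 1 1)
    (by rw [lp.norm_single (by norm_num)]; simp)
    -- The two translations send `δ_1` to the basis vector at `x_e · 1 · x_e⁻¹ = 1`, and the two
    -- scalars multiply to `χ(x_e²) = 1`.
    (fun e => by
      rw [hA, hB, smul_apply, smul_apply, map_smul,
        permOp_single, permOp_single, smul_smul, ← Units.val_mul, ← map_mul, ← pow_two, edgeElt_sq]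
      simp [left, right])
  refine ⟨S, hS, hSν, fun x e q => ?_⟩
  rw [hSX, hA, smul_apply, permOp_single]
  rfl

lemma single_injective {Q : Type w} [DecidableEq Q] {q q' : Q}
    (h : lp.single (E := fun _ : Q => ℂ) 2 q 1 = lp.single 2 q' 1) : q = q' := by
  by_contra hne
  have := congrArg (fun ξ : lp (fun _ : Q => ℂ) 2 => ξ q) h
  simp [hne] at this

/-- Commutation on the state alone suffices: in the regular strategy on `Γ(G, b)/⟨J⟩` the state is
`δ_1`, and a translation is determined by its value there. The sign character then lifts
commutativity from the quotient to the group. -/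
theorem commute_of_strategy_commute {b : V(G) → ZMod 2} [G.Loopless] [Finite V(G)] [Finite E(G)]
    (hb : EvenOnComponents b)
    (h : ∀ (H : Type w) [NormedAddCommGroup H] [InnerProductSpace ℂ H] [CompleteSpace H]
        (S : CommutingOperatorStrategy b H), S.IsPerfect → ∀ x e y e',
          S.X x e (S.X y e' S.ν) = S.X y e' (S.X x e S.ν))
    (z z' : IncidenceGroup b) : z * z' = z' * z := by
  classical
  obtain ⟨f, hf⟩ := hb.exists_solution
  obtain ⟨χ, hχJ, hχ⟩ := exists_sign_character hf
  let N : Subgroup (IncidenceGroup b) := Subgroup.zpowers (centralElt b)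
  have hN : N ≤ Subgroup.center _ := (Subgroup.zpowers_le).2 centralElt_mem_center
  have : N.Normal := ⟨fun t ht g => by
    rwa [Subgroup.mem_center_iff.1 (hN ht) g, mul_inv_cancel_right]⟩
  have : Countable (IncidenceGroup b ⧸ N) := (QuotientGroup.mk'_surjective N).countable
  let σ := Shrink.mulEquiv.{w} (α := IncidenceGroup b ⧸ N)
  let p : IncidenceGroup b →* Shrink.{w} (IncidenceGroup b ⧸ N) :=
    σ.symm.toMonoidHom.comp (QuotientGroup.mk' N)
  have hp (t) : p t = 1 ↔ t ∈ N := by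
    simp [p]
  obtain ⟨S, hS, hSν, hSX⟩ := exists_regular_strategy χ hχJ hχ p
    ((hp _).2 (Subgroup.mem_zpowers _))
  have hedge (e e' : E(G)) : Commute (p (edgeElt b e)) (p (edgeElt b e')) := by
    obtain ⟨x, hx⟩ := exists_mem_incidenceSet e
    obtain ⟨y, hy⟩ := exists_mem_incidenceSet e'
    have := h _ S hS x ⟨e.1, hx⟩ y ⟨e'.1, hy⟩
    rw [hSν, hSX, hSX, map_smul, map_smul, hSX, hSX, smul_comm] at this
    have hne (t) : (χ t : ℂ) ≠ 0 := (χ t).ne_zero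
    have := single_injective (smul_right_injective _ (hne _) (smul_right_injective _ (hne _) this))
    simpa [Commute, SemiconjBy, toEdge] using this
  have hcomm (t t') : Commute (p t) (p t') := by
    induction t using incidenceGroup_induction with
    | one => simp
    | mul t s ht hs => rw [map_mul]; exact ht.mul_left hs
    | inv t ht => rw [map_inv]; exact ht.inv_left
    | center => rw [(hp _).2 (Subgroup.mem_zpowers _)]; exact Commute.one_left _
    | edge e =>
      induction t' using incidenceGroup_induction with
      | one => simp
      | mul t s ht hs => rw [map_mul]; exact ht.mul_right hs
      | inv t ht => rw [map_inv]; exact ht.inv_right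
      | center => rw [(hp _).2 (Subgroup.mem_zpowers _)]; exact Commute.one_right _
      | edge e' => exact hedge e e'
  have hmem : z * z' * (z' * z)⁻¹ ∈ N := by
    rw [← hp, map_mul, map_inv, map_mul, map_mul, (hcomm z z').eq, mul_inv_cancel]
  obtain ⟨n, hn⟩ := Subgroup.mem_zpowers_iff.1 hmem
  refine mul_inv_eq_one.1 ?_
  -- The commutator is a power of `J`, and `χ` sends it to `1`; since `χ(J) = -1`, the exponent is
  -- even, so the power is trivial.
  have h1 : χ (z * z' * (z' * z)⁻¹) = 1 := by
    rw [map_mul, map_inv, map_mul, map_mul, mul_comm (χ z), mul_inv_cancel]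
  rw [← hn, map_zpow, hχJ] at h1
  rw [← hn]
  rcases Int.even_or_odd n with ⟨k, rfl⟩ | hodd
  · rw [← two_mul, zpow_mul, zpow_ofNat, centralElt_sq, one_zpow]
  · rw [hodd.neg_one_zpow] at h1
    have := congrArg Units.val h1
    norm_num at this

/-! ### Signs and joint spectral idempotents. -/

lemma neg_one_pow_val_sq {R : Type*} [Monoid R] [HasDistribNeg R] (a : ZMod 2) :
    (-1 : R) ^ a.val * (-1) ^ a.val = 1 := by
  rw [← pow_add, ← two_mul, pow_mul]; simp

lemma neg_one_pow_val_injective : Function.Injective fun a : ZMod 2 => (-1 : ℂ) ^ a.val := by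
  have h : ∀ a : ZMod 2, a = 0 ∨ a = 1 := by decide
  intro a a' haa'
  rcases h a with rfl | rfl <;> rcases h a' with rfl | rfl <;>
    simp [ZMod.val_one] at haa' ⊢ <;> norm_num at haa'

lemma neg_one_pow_list_sum (l : List (ZMod 2)) :
    (l.map fun a => (-1 : ℂ) ^ a.val).prod = (-1) ^ l.sum.val := by
  induction l with
  | nil => simp
  | cons a l ih =>
    rw [List.map_cons, List.prod_cons, ih, List.sum_cons, ← pow_add, ZMod.val_add,
      ← pow_eq_pow_mod _ (by simp)]

/-- Commuting involutions in a complex algebra have joint spectral idempotents summing to `1`. -/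
theorem exists_joint_idempotents {A ι : Type*} [CommRing A] [Algebra ℂ A] [Fintype ι]
    [DecidableEq ι]     (x : ι → A) (hx : ∀ i, x i * x i = 1) :
    ∃ p : (ι → ZMod 2) → A, ∑ φ, p φ = 1 ∧ ∀ φ i, x i * p φ = ((-1 : ℂ) ^ (φ i).val) • p φ := by
  -- The idempotent is the product of the spectral projections `(1 ± x_i)/2`. Expanding the product
  -- over `i` of the two projections' sum, which is `1`, gives the partition of unity.
  refine ⟨fun φ => ∏ i, (2⁻¹ : ℂ) • (1 + ((-1 : ℂ) ^ (φ i).val) • x i), ?_, fun φ i => ?_⟩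
  · have := Finset.prod_univ_sum (fun _ : ι => (Finset.univ : Finset (ZMod 2)))
      fun i a => (2⁻¹ : ℂ) • (1 + ((-1 : ℂ) ^ a.val) • x i)
    rw [Fintype.piFinset_univ] at this
    rw [← this]
    refine Finset.prod_eq_one fun i _ => ?_
    have huniv : (Finset.univ : Finset (ZMod 2)) = {0, 1} := by decide
    rw [huniv, Finset.sum_pair (by decide)]
    simp only [ZMod.val_zero, ZMod.val_one, pow_zero, pow_one]
    module
  · beta_reduce
    rw [← Finset.mul_prod_erase _ _ (Finset.mem_univ i), ← mul_assoc, ← smul_mul_assoc]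
    congr 1
    have hs := neg_one_pow_val_sq (R := ℂ) (φ i)
    rw [mul_smul_comm, mul_add, mul_one, mul_smul_comm, hx]
    linear_combination (norm := module) (-(2⁻¹ : ℂ) * hs) • x i

/-! ### Perfect strategies as representations of the incidence group. -/

namespace CommutingOperatorStrategy

variable {b : V(G) → ZMod 2} {H : Type w} [NormedAddCommGroup H] [InnerProductSpace ℂ H]
  [CompleteSpace H] (S : CommutingOperatorStrategy b H)

lemma X_sq (x e) : S.X x e * S.X x e = 1 := by
  have h := S.observable_X x e
  have := (Unitary.mem_iff.1 h.2).1
  rwa [h.1.star_eq] at this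

lemma X_apply_X (x e) (ξ : H) : S.X x e (S.X x e ξ) = ξ :=
  congrArg (fun T : H →L[ℂ] H => T ξ) (S.X_sq x e)

lemma norm_Y (x e) (ξ : H) : ‖S.Y x e ξ‖ = ‖ξ‖ :=
  (ContinuousLinearMap.norm_map_iff_adjoint_comp_self _).2
    (Unitary.mem_iff.1 (S.observable_Y x e).2).1 ξ

lemma norm_X (x e) (ξ : H) : ‖S.X x e ξ‖ = ‖ξ‖ :=
  (ContinuousLinearMap.norm_map_iff_adjoint_comp_self _).2
    (Unitary.mem_iff.1 (S.observable_X x e).2).1 ξ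

variable {S}

/-- Two unit vectors with inner product `1` coincide; the involution `X` is then moved to the other
side. -/
lemma IsPerfect.Y_eq_X (hS : S.IsPerfect) {x y : V(G)} {e : β} (hx : e ∈ G.incidenceSet x)
    (hy : e ∈ G.incidenceSet y) : S.Y y ⟨e, hy⟩ S.ν = S.X x ⟨e, hx⟩ S.ν := by
  have h : S.ν = S.X x ⟨e, hx⟩ (S.Y y ⟨e, hy⟩ S.ν) := by
    refine (inner_eq_one_iff_of_norm_eq_one (𝕜 := ℂ) S.norm_ν ?_).1 (hS x y e hx hy)
    rw [norm_X, norm_Y, S.norm_ν]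
  have := congrArg (S.X x ⟨e, hx⟩) h
  rw [X_apply_X] at this
  exact this.symm

variable (S)

/-- The vectors `T ν`, where `T` commutes with all operators of the first player. -/
noncomputable def cyclicSpace : Submodule ℂ H :=
  (Subalgebra.toSubmodule (Subalgebra.centralizer ℂ
    {T : H →L[ℂ] H | ∃ x e, S.X x e = T})).map
    (ContinuousLinearMap.apply ℂ H S.ν).toLinearMap

variable {S}

lemma mem_cyclicSpace {ξ : H} :
    ξ ∈ S.cyclicSpace ↔ ∃ T : H →L[ℂ] H, (∀ x e, Commute (S.X x e) T) ∧ T S.ν = ξ := by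
  constructor
  · rintro ⟨T, hT, rfl⟩
    exact ⟨T, fun x e => (Subalgebra.mem_centralizer_iff ℂ).1 hT _ ⟨x, e, rfl⟩, rfl⟩
  · rintro ⟨T, hT, rfl⟩
    exact ⟨T, (Subalgebra.mem_centralizer_iff ℂ).2 (by rintro _ ⟨x, e, rfl⟩; exact hT x e), rfl⟩

lemma ν_mem_cyclicSpace : S.ν ∈ S.cyclicSpace :=
  mem_cyclicSpace.2 ⟨1, fun _ _ => Commute.one_right _, rfl⟩

lemma Y_mem_cyclicSpace (x e) {ξ : H} (hξ : ξ ∈ S.cyclicSpace) : S.Y x e ξ ∈ S.cyclicSpace := by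
  obtain ⟨T, hT, rfl⟩ := mem_cyclicSpace.1 hξ
  exact mem_cyclicSpace.2 ⟨S.Y x e * T, fun y e' => (S.commute_X_Y _ _ _ _).mul_right (hT y e'), rfl⟩

lemma X_apply_of_commute (x e) {T : H →L[ℂ] H} (hT : ∀ x e, Commute (S.X x e) T) :
    S.X x e (T S.ν) = T (S.X x e S.ν) :=
  congrArg (fun T : H →L[ℂ] H => T S.ν) (hT x e).eq

/-- On the state, `X` can be traded for `Y`: `X T ν = T X ν = T Y ν`, and `T Y` is again in the
commutant. -/
lemma IsPerfect.X_mem_cyclicSpace (hS : S.IsPerfect) (x e) {ξ : H} (hξ : ξ ∈ S.cyclicSpace) :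
    S.X x e ξ ∈ S.cyclicSpace := by
  obtain ⟨T, hT, rfl⟩ := mem_cyclicSpace.1 hξ
  refine mem_cyclicSpace.2 ⟨T * S.Y x e, fun y e' => (hT y e').mul_right (S.commute_X_Y _ _ _ _), ?_⟩
  rw [X_apply_of_commute _ _ hT, ← hS.Y_eq_X e.2 e.2]
  rfl

/-- Both operators take `ν` to the same vector `Y ν`, and the commutant carries this equality to the
whole cyclic space. -/
lemma IsPerfect.X_eq_X_of_mem (hS : S.IsPerfect) {x y : V(G)} {e : β} (hx : e ∈ G.incidenceSet x)
    (hy : e ∈ G.incidenceSet y) {ξ : H} (hξ : ξ ∈ S.cyclicSpace) :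
    S.X x ⟨e, hx⟩ ξ = S.X y ⟨e, hy⟩ ξ := by
  obtain ⟨T, hT, rfl⟩ := mem_cyclicSpace.1 hξ
  rw [X_apply_of_commute _ _ hT, X_apply_of_commute _ _ hT, ← hS.Y_eq_X hx hx, ← hS.Y_eq_X hy hx]

/-- The operators of the first player in a perfect strategy represent the incidence group on the
cyclic space. -/
theorem IsPerfect.exists_representation (hS : S.IsPerfect) :
    ∃ ρ : IncidenceGroup b →* Module.End ℂ S.cyclicSpace,
      ρ (centralElt b) = -1 ∧
      ∀ x e ξ, (ρ (edgeElt b (toEdge x e)) ξ : H) = S.X x e ξ := by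
  let XK (x : V(G)) (e : G.incidenceSet x) : Module.End ℂ S.cyclicSpace :=
    (S.X x e).toLinearMap.restrict fun ξ hξ => hS.X_mem_cyclicSpace x e hξ
  have hsq (x e) : XK x e * XK x e = 1 := LinearMap.ext fun ξ => Subtype.ext (S.X_apply_X x e ξ)
  let U (x : V(G)) (e : G.incidenceSet x) : (Module.End ℂ S.cyclicSpace)ˣ :=
    ⟨XK x e, XK x e, hsq x e, hsq x e⟩
  -- Each `x_e` is represented through an arbitrary endpoint of `e`; on the cyclic space the choice
  -- is immaterial (`hU`), so the relations at every vertex can be checked with that vertex's own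
  -- operators.
  choose v hv using exists_mem_incidenceSet (G := G)
  have hU (x : V(G)) (e : G.incidenceSet x) : U (v (toEdge x e)) ⟨(toEdge x e).1, hv _⟩ = U x e :=
    Units.ext (LinearMap.ext fun ξ => Subtype.ext (hS.X_eq_X_of_mem _ e.2 ξ.2))
  obtain ⟨ρ, hJ, hρ⟩ := exists_incidenceGroup_hom (b := b) (-1) (fun e => U (v e) ⟨e.1, hv e⟩)
    (by simp) (fun e => Units.ext (by rw [pow_two]; exact hsq _ _))
    (fun _ => Commute.neg_one_right _)
    (fun x e e' => by
      rw [hU, hU]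
      refine Units.ext (LinearMap.ext fun ξ => Subtype.ext ?_)
      exact congrArg (fun T : H →L[ℂ] H => T ξ) (S.commute_X x e e').eq)
    (fun x l hl => by
      simp only [hU]
      refine Units.ext (LinearMap.ext fun ξ => Subtype.ext ?_)
      have key (l : List (G.incidenceSet x)) :
          ((((l.map fun e => U x e).prod : (Module.End ℂ S.cyclicSpace)ˣ) :
            Module.End ℂ S.cyclicSpace) ξ : H) = (l.map (S.X x)).prod ξ := by
        induction l with
        | nil => rfl
        | cons e l ih =>
          simp only [List.map_cons, List.prod_cons, mul_apply_eq_comp, ← ih]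
          rfl
      rw [key, S.prod_X x l hl]
      rcases Nat.even_or_odd (b x).val with h | h <;> simp [h.neg_one_pow])
  refine ⟨(Units.coeHom _).comp ρ, ?_, fun x e ξ => ?_⟩
  · rw [MonoidHom.comp_apply, hJ]; rfl
  · rw [MonoidHom.comp_apply, hρ, hU]; rfl

/-- If the incidence group is abelian, the state of a perfect strategy is a sum of joint
eigenvectors on which the two players' operators agree. -/
theorem IsPerfect.exists_joint_eigenvectors [Fintype E(G)] [DecidableEq E(G)]
    (hS : S.IsPerfect)
    (hcomm : ∀ z z' : IncidenceGroup b, z * z' = z' * z) :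
    ∃ ψ : (E(G) → ZMod 2) → H, ∑ φ, ψ φ = S.ν ∧ ∀ φ x e,
      S.X x e (ψ φ) = ((-1 : ℂ) ^ (φ (toEdge x e)).val) • ψ φ ∧
      S.Y x e (ψ φ) = ((-1 : ℂ) ^ (φ (toEdge x e)).val) • ψ φ := by
  obtain ⟨ρ, hρJ, hρ⟩ := hS.exists_representation
  -- The idempotents are built in the group algebra, which is commutative here, and then pushed into
  -- the noncommutative endomorphism ring.
  let _ : CommGroup (IncidenceGroup b) := { mul_comm := hcomm }
  let ρ' : MonoidAlgebra ℂ (IncidenceGroup b) →ₐ[ℂ] Module.End ℂ S.cyclicSpace :=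
    MonoidAlgebra.lift ℂ _ _ ρ
  let X (e : E(G)) : MonoidAlgebra ℂ (IncidenceGroup b) := MonoidAlgebra.of ℂ _ (edgeElt b e)
  have hX (e) : ρ' (X e) = ρ (edgeElt b e) := MonoidAlgebra.lift_of _ _
  obtain ⟨p, hp, hXp⟩ := exists_joint_idempotents X fun e => by
    rw [← map_mul, ← pow_two, edgeElt_sq, map_one]
  let ν : S.cyclicSpace := ⟨S.ν, ν_mem_cyclicSpace⟩
  have hXψ (φ x e) : S.X x e (ρ' (p φ) ν) =
      ((-1 : ℂ) ^ (φ (toEdge x e)).val) • (ρ' (p φ) ν : H) := by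
    rw [← hρ, ← hX, ← Module.End.mul_apply, ← map_mul, hXp, map_smul]
    rfl
  let YK (x : V(G)) (e : G.incidenceSet x) : Module.End ℂ S.cyclicSpace :=
    (S.Y x e).toLinearMap.restrict fun ξ hξ => Y_mem_cyclicSpace x e hξ
  have hYρ (x e z) : Commute (YK x e) (ρ z) := by
    induction z using incidenceGroup_induction with
    | one => rw [map_one]; exact Commute.one_right _
    | mul z z' h h' => rw [map_mul]; exact h.mul_right h'
    | inv z h =>
      have h' : Commute (YK x e) (ρ.toHomUnits z : Module.End ℂ S.cyclicSpace) := h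
      have := h'.units_inv_right
      rwa [← map_inv] at this
    | center => rw [hρJ]; exact Commute.neg_one_right (YK x e)
    | edge e' =>
      obtain ⟨y, hy⟩ := exists_mem_incidenceSet e'
      refine LinearMap.ext fun ξ => Subtype.ext ?_
      have h1 := hρ y ⟨e'.1, hy⟩
      change ∀ ξ, (ρ (edgeElt b e') ξ : H) = _ at h1
      change S.Y x e (ρ _ _ : H) = (ρ _ (YK x e ξ) : H)
      rw [h1, h1]
      exact congrArg (fun T : H →L[ℂ] H => T ξ) (S.commute_X_Y _ _ _ _).eq.symm
  have hYρ' (x e r) : Commute (YK x e) (ρ' r) := by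
    induction r using MonoidAlgebra.induction_on with
    | of z => rw [MonoidAlgebra.lift_of]; exact hYρ x e z
    | add r s hr hs => rw [map_add]; exact hr.add_right hs
    | smul c r hr => rw [map_smul]; exact hr.smul_right c
  refine ⟨fun φ => ρ' (p φ) ν, ?_, fun φ x e => ⟨hXψ φ x e, ?_⟩⟩
  · have := congrArg (fun r => (ρ' r ν : H)) hp
    simpa [map_sum, LinearMap.sum_apply] using this
  -- `Y p_φ ν = p_φ Y ν = p_φ X ν`, and `X` acts on `p_φ` by the sign.
  · have hYν : YK x e ν = ρ' (X (toEdge x e)) ν := Subtype.ext <| by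
      rw [hX, hρ]
      exact hS.Y_eq_X e.2 e.2
    change (YK x e (ρ' (p φ) ν) : H) = _
    rw [← Module.End.mul_apply, (hYρ' x e _).eq, Module.End.mul_apply, hYν,
      ← Module.End.mul_apply, ← map_mul, mul_comm, hXp, map_smul]
    rfl

end CommutingOperatorStrategy

/-! ### From joint eigenvectors to deterministic strategies. -/

variable {b : V(G) → ZMod 2}

/-- The deterministic strategy in which both players answer from a solution of the incidence
system. -/
def DeterministicStrategy.ofSolution (φ : E(G) → ZMod 2)
    (hφ : ∀ x, ∑ᶠ e, φ (toEdge x e) = b x) : DeterministicStrategy b where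
  f x e := φ (toEdge x e)
  g x e := φ (toEdge x e)
  sum_f := hφ
  sum_g := hφ

lemma DeterministicStrategy.ofSolution_injective {φ φ' : E(G) → ZMod 2}
    {hφ : ∀ x, ∑ᶠ e, φ (toEdge x e) = b x} {hφ' : ∀ x, ∑ᶠ e, φ' (toEdge x e) = b x}
    (h : ofSolution φ hφ = ofSolution φ' hφ') : φ = φ' := by
  funext e
  obtain ⟨x, hx⟩ := exists_mem_incidenceSet e
  exact congrFun (congrFun (congrArg DeterministicStrategy.f h) x) ⟨e.1, hx⟩

namespace CommutingOperatorStrategy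

variable {H : Type w} [NormedAddCommGroup H] [InnerProductSpace ℂ H] [CompleteSpace H]
  {S : CommutingOperatorStrategy b H}

/-- The product of the operators at `x` acts on `ψ` by `(-1)` to the sum of the labels, and by
`(-1)^{b x}` according to the strategy; a nonzero `ψ` lets the signs be compared. -/
lemma sum_eq_of_joint_eigenvector [Finite E(G)] {φ : E(G) → ZMod 2} {ψ : H} (hψ : ψ ≠ 0)
    (h : ∀ x e, S.X x e ψ = ((-1 : ℂ) ^ (φ (toEdge x e)).val) • ψ) (x : V(G)) :
    ∑ᶠ e, φ (toEdge x e) = b x := by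
  obtain ⟨l, hl⟩ := exists_isEnumeration (G.incidenceSet x)
  have key (l : List (G.incidenceSet x)) : (l.map (S.X x)).prod ψ =
      (l.map fun e => (-1 : ℂ) ^ (φ (toEdge x e)).val).prod • ψ := by
    induction l with
    | nil => simp
    | cons e l ih =>
      simp only [List.map_cons, List.prod_cons, mul_apply_eq_comp, ih, map_smul, h,
        smul_smul, mul_comm]
  have h1 := key l
  have h2 := neg_one_pow_list_sum (l.map fun e => φ (toEdge x e))
  rw [List.map_map, Function.comp_def] at h2
  rw [S.prod_X x l hl, h2, hl.sum_eq] at h1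
  exact (neg_one_pow_val_injective (smul_left_injective ℂ hψ h1)).symm

/-- Some self-adjoint `X` has different real eigenvalues on the two vectors. -/
lemma inner_eq_zero_of_joint_eigenvectors {φ φ' : E(G) → ZMod 2} {ψ ψ' : H}
    (h : ∀ x e, S.X x e ψ = ((-1 : ℂ) ^ (φ (toEdge x e)).val) • ψ)
    (h' : ∀ x e, S.X x e ψ' = ((-1 : ℂ) ^ (φ' (toEdge x e)).val) • ψ') (hne : φ ≠ φ') :
    inner ℂ ψ ψ' = 0 := by
  obtain ⟨e, he⟩ := Function.ne_iff.1 hne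
  obtain ⟨x, hx⟩ := exists_mem_incidenceSet e
  have h1 : inner ℂ (S.X x ⟨e.1, hx⟩ ψ) ψ' = inner ℂ ψ (S.X x ⟨e.1, hx⟩ ψ') :=
    (ContinuousLinearMap.isSelfAdjoint_iff_isSymmetric.1 (S.observable_X x _).1) ψ ψ'
  rw [h, h', inner_smul_left, inner_smul_right, map_pow, map_neg, map_one] at h1
  by_contra h0
  exact he (neg_one_pow_val_injective (mul_right_cancel₀ h0 h1))

/-- A state which is a sum of joint eigenvectors indexed by labellings of the edges decomposes
orthogonally along deterministic strategies. -/
theorem exists_decomposition [Fintype E(G)] [DecidableEq E(G)] {k : ℕ}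
    (D : Fin k ≃ DeterministicStrategy b) {ψ : (E(G) → ZMod 2) → H} (hsum : ∑ φ, ψ φ = S.ν)
    (hX : ∀ φ x e, S.X x e (ψ φ) = ((-1 : ℂ) ^ (φ (toEdge x e)).val) • ψ φ)
    (hY : ∀ φ x e, S.Y x e (ψ φ) = ((-1 : ℂ) ^ (φ (toEdge x e)).val) • ψ φ) :
    ∃ H₀ : Submodule ℂ H, S.ν ∈ H₀ ∧
      (∀ (x : V(G)) (e : G.incidenceSet x),
        (∀ ξ ∈ H₀, S.X x e ξ ∈ H₀) ∧ (∀ ξ ∈ H₀, S.Y x e ξ ∈ H₀)) ∧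
      ∃ (m : ℕ) (i : Fin m → Fin k) (μ : OrthonormalBasis (Fin m) ℂ H₀) (c : Fin m → ℝ),
        StrictMono i ∧ (∀ j, 0 < c j) ∧ S.ν = ∑ j, (c j : ℂ) • (μ j : H) ∧
        ∀ (x : V(G)) (e : G.incidenceSet x), ∀ ξ ∈ H₀,
          S.X x e ξ = ∑ j, ((-1 : ℂ) ^ ((D (i j)).f x e).val * inner ℂ (μ j : H) ξ) • (μ j : H) ∧
          S.Y x e ξ = ∑ j, ((-1 : ℂ) ^ ((D (i j)).g x e).val * inner ℂ (μ j : H) ξ) •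
            (μ j : H) := by
  classical
  -- Only the nonzero components are kept: they can be normalised, have positive norms as
  -- coefficients, and their labels solve the system.
  let T := {φ : E(G) → ZMod 2 // ψ φ ≠ 0}
  let t : T → Fin k := fun φ =>
    D.symm (.ofSolution φ.1 (sum_eq_of_joint_eigenvector φ.2 (hX φ.1)))
  have ht : Function.Injective t := fun φ φ' h =>
    Subtype.ext (DeterministicStrategy.ofSolution_injective (D.symm.injective h))
  let I : Finset (Fin k) := Finset.univ.image t
  let E : T ≃ I := (Equiv.ofInjective t ht).trans (Equiv.subtypeEquivRight fun i => by simp [I])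
  -- The occurring strategies are listed by increasing index, so that the sequence of indices is
  -- strictly monotone.
  let O : Fin I.card ≃ I := (I.orderIsoOfFin rfl).toEquiv
  let τ : Fin I.card ≃ T := O.trans E.symm
  have hτ (j) : t (τ j) = O j := by
    have : E (τ j) = O j := E.apply_symm_apply _
    rw [← this]
    rfl
  let μ₀ : Fin I.card → H := fun j => ((‖ψ (τ j).1‖ : ℂ)⁻¹) • ψ (τ j).1
  have hnorm (j) : (‖ψ (τ j).1‖ : ℂ) ≠ 0 := by simpa using (τ j).2
  have hμ₀ : Orthonormal ℂ μ₀ := by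
    refine ⟨fun j => ?_, fun j j' hne => ?_⟩
    · exact norm_smul_inv_norm (𝕜 := ℂ) (τ j).2
    · simp only [μ₀]
      rw [inner_smul_left, inner_smul_right, inner_eq_zero_of_joint_eigenvectors (hX _) (hX _),
        mul_zero, mul_zero]
      exact fun h => hne (τ.injective (Subtype.ext h))
  have hspan (j) : μ₀ j ∈ Submodule.span ℂ (Set.range μ₀) := Submodule.subset_span ⟨j, rfl⟩
  let μ : OrthonormalBasis (Fin I.card) ℂ (Submodule.span ℂ (Set.range μ₀)) :=
    OrthonormalBasis.mk (v := fun j => ⟨μ₀ j, hspan j⟩)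
      ⟨fun j => hμ₀.1 j, fun j j' hne => hμ₀.2 hne⟩ (by
        rw [← Submodule.map_le_map_iff_of_injective
            (Submodule.span ℂ (Set.range μ₀)).injective_subtype,
          Submodule.map_span, ← Set.range_comp, Submodule.map_top, Submodule.range_subtype]
        rfl)
  have hμ (j) : (μ j : H) = μ₀ j :=
    congrArg Subtype.val (congrFun (OrthonormalBasis.coe_mk _ _) j)
  have hν : S.ν = ∑ j, ((‖ψ (τ j).1‖ : ℝ) : ℂ) • (μ j : H) := by
    have h1 (j) : ((‖ψ (τ j).1‖ : ℝ) : ℂ) • (μ j : H) = ψ (τ j).1 := by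
      rw [hμ, smul_inv_smul₀ (hnorm j)]
    simp only [h1]
    rw [← hsum, Equiv.sum_comp τ fun φ : T => ψ φ.1,
      ← Finset.sum_subtype (Finset.univ.filter fun φ => ψ φ ≠ 0) (by simp), Finset.sum_filter_ne_zero]
  have hact (F : H →L[ℂ] H) (s : Fin I.card → ℂ) (hF : ∀ j, F (μ j) = s j • (μ j : H)) (ξ : H)
      (hξ : ξ ∈ Submodule.span ℂ (Set.range μ₀)) :
      F ξ = ∑ j, (s j * inner ℂ (μ j : H) ξ) • (μ j : H) := by
    have h : _ = ξ := congrArg Subtype.val (μ.sum_repr' ⟨ξ, hξ⟩)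
    rw [Submodule.coe_sum] at h
    conv_lhs => rw [← h]
    rw [map_sum]
    refine Finset.sum_congr rfl fun j _ => ?_
    rw [Submodule.coe_smul, map_smul, hF, smul_smul, mul_comm]
    rfl
  have hDf (j x e) : (D (O j)).f x e = (τ j).1 (toEdge x e) := by
    rw [← hτ, D.apply_symm_apply]; rfl
  have hDg (j x e) : (D (O j)).g x e = (τ j).1 (toEdge x e) := by
    rw [← hτ, D.apply_symm_apply]; rfl
  have hXact (x e) := hact (S.X x e) (fun j => (-1 : ℂ) ^ ((D (O j)).f x e).val) fun j => by
    rw [hμ, hDf, map_smul, hX, smul_comm]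
  have hYact (x e) := hact (S.Y x e) (fun j => (-1 : ℂ) ^ ((D (O j)).g x e).val) fun j => by
    rw [hμ, hDg, map_smul, hY, smul_comm]
  refine ⟨Submodule.span ℂ (Set.range μ₀), ?_, fun x e => ⟨fun ξ hξ => ?_, fun ξ hξ => ?_⟩,
    I.card, fun j => O j, μ, fun j => ‖ψ (τ j).1‖, fun j j' h => (I.orderIsoOfFin rfl).strictMono h,
    fun j => norm_pos_iff.2 (τ j).2, hν, fun x e ξ hξ => ⟨hXact x e ξ hξ, hYact x e ξ hξ⟩⟩
  · rw [hν]; exact sum_mem fun j _ => Submodule.smul_mem _ _ (μ j).2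
  · rw [hXact x e ξ hξ]; exact sum_mem fun j _ => Submodule.smul_mem _ _ (μ j).2
  · rw [hYact x e ξ hξ]; exact sum_mem fun j _ => Submodule.smul_mem _ _ (μ j).2

end CommutingOperatorStrategy

lemma diagonal_apply {H : Type*} [NormedAddCommGroup H] [InnerProductSpace ℂ H] {m : ℕ}
    {H₀ : Submodule ℂ H} (μ : OrthonormalBasis (Fin m) ℂ H₀) (s : Fin m → ℂ) {F : H → H}
    (hF : ∀ ξ ∈ H₀, F ξ = ∑ j, (s j * inner ℂ (μ j : H) ξ) • (μ j : H)) {ξ : H} (hξ : ξ ∈ H₀) (j) :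
    inner ℂ (μ j : H) (F ξ) = s j * inner ℂ (μ j : H) ξ := by
  have h (i) : inner ℂ (μ j : H) (μ i : H) = if j = i then 1 else 0 :=
    orthonormal_iff_ite.1 μ.orthonormal j i
  simp [hF ξ hξ, h]

end GraphIncidence

theorem corollary2p8 {α : Type u} {β : Type v} (G : Graph α β) [G.Loopless]
    [Finite V(G)] [Finite E(G)] (b : V(G) → ZMod 2)
    (hb : GraphIncidence.EvenOnComponents b)
    (k : ℕ) (D : Fin k ≃ GraphIncidence.DeterministicStrategy b) :
    (∀ z z' : GraphIncidence.IncidenceGroup b, z * z' = z' * z) ↔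
      ∀ (H : Type w) [NormedAddCommGroup H] [InnerProductSpace ℂ H] [CompleteSpace H]
        (S : GraphIncidence.CommutingOperatorStrategy b H), S.IsPerfect →
        ∃ H₀ : Submodule ℂ H, S.ν ∈ H₀ ∧
          (∀ (x : V(G)) (e : G.incidenceSet x),
            (∀ ξ ∈ H₀, S.X x e ξ ∈ H₀) ∧ (∀ ξ ∈ H₀, S.Y x e ξ ∈ H₀)) ∧
          ∃ (m : ℕ) (i : Fin m → Fin k) (μ : OrthonormalBasis (Fin m) ℂ H₀) (c : Fin m → ℝ),
            StrictMono i ∧ (∀ j, 0 < c j) ∧ S.ν = ∑ j, (c j : ℂ) • (μ j : H) ∧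
            ∀ (x : V(G)) (e : G.incidenceSet x), ∀ ξ ∈ H₀,
              S.X x e ξ = ∑ j, ((-1 : ℂ) ^ ((D (i j)).f x e).val * inner ℂ (μ j : H) ξ) •
                (μ j : H) ∧
              S.Y x e ξ = ∑ j, ((-1 : ℂ) ^ ((D (i j)).g x e).val * inner ℂ (μ j : H) ξ) •
                (μ j : H) := by
  classical
  have := Fintype.ofFinite E(G)
  constructor
  · intro hcomm H _ _ _ S hS
    obtain ⟨ψ, hsum, hψ⟩ := hS.exists_joint_eigenvectors hcomm
    exact GraphIncidence.CommutingOperatorStrategy.exists_decomposition D hsum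
      (fun φ x e => (hψ φ x e).1) (fun φ x e => (hψ φ x e).2)
  · intro h
    refine GraphIncidence.commute_of_strategy_commute.{u, v, w} hb
      fun H _ _ _ S hS x e y e' => ?_
    obtain ⟨H₀, hν, hinv, m, i, μ, c, -, -, -, hdiag⟩ := h H S hS
    have hX (x e) {ξ : H} (hξ : ξ ∈ H₀) (j) :=
      GraphIncidence.diagonal_apply μ _ (fun ξ hξ => (hdiag x e ξ hξ).1) hξ j
    have h1 := (hinv x e).1 _ hν
    have h2 := (hinv y e').1 _ hν
    rw [(hdiag x e _ h2).1, (hdiag y e' _ h1).1]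
    refine Finset.sum_congr rfl fun j _ => ?_
    rw [hX y e' hν, hX x e hν, mul_left_comm]
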